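/- Let $\mathbb{F}_2[x^2,x^3]$ be the subring of $\mathbb{F}_2[x]$ generated over $\mathbb{F}_2$ by $x^2$ and $x^3$, and for $n\ge 0$ let $b(n)$ be the number of polynomials of degree $n$ in $\mathbb{F}_2[x^2,x^3]$ that are irreducible as elements of the ring $\mathbb{F}_2[x^2,x^3]$. Let $\mu$ be the Möbius function, and for $n\ge 1$ put $$a(n)=\frac1n\sum_{d\mid n}\mu(n/d)\,2^d,\qquad r(n)=\frac1{2n}\sum_{\substack{d\mid n\\ d\text{ odd}}}\mu(d)\,2^{n/d}.$$ Then for every $n\ge 4$, $$b(n)=\bigl(a(n)-r(n)\bigr)+\bigl(r(n-2)+r(n-3)\bigr)+w(n),$$ where $$w(n)=\begin{cases}\displaystyle\sum_{k=1}^{n/2-1} r(k)\,r(n-k)+\frac{r(n/2)\,(r(n/2)+1)}{2} & \text{if } n \text{ is even},\\[1em] \displaystyle\sum_{k=1}^{\lfloor n/2\rfloor} r(k)\,r(n-k) & \text{if } n \text{ is odd}.\end{cases}$$ In the remaining degrees, $b(0)=b(1)=0$, $b(2)=2$ and $b(3)=4$. -/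

import Mathlib

open Polynomial

/-- The ring `F₂[x², x³]`: the subalgebra of `F₂[x]` generated by `x²` and `x³`. -/
noncomputable def cuspRing : Subalgebra (ZMod 2) (ZMod 2)[X] :=
  Algebra.adjoin (ZMod 2) {X ^ 2, X ^ 3}

/-- `b(n)`: the number of elements of degree `n` that are irreducible in the ring `F₂[x², x³]`. -/
noncomputable def cuspIrredCount (n : ℕ) : ℕ :=
  Set.ncard {f : cuspRing | Irreducible f ∧ (f : (ZMod 2)[X]).natDegree = n}

/-- `(1/n) ∑_{d ∣ n} μ(n/d) 2^d`, as a rational number. -/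
def necklaceFormula (n : ℕ) : ℚ :=
  (1 / (n : ℚ)) * ∑ d ∈ n.divisors, (ArithmeticFunction.moebius (n / d) : ℚ) * 2 ^ d

/-- `(1/(2n)) ∑_{d ∣ n, d odd} μ(d) 2^{n/d}`, as a rational number. -/
def selfReciprocalFormula (n : ℕ) : ℚ :=
  (1 / (2 * (n : ℚ))) *
    ∑ d ∈ n.divisors with Odd d, (ArithmeticFunction.moebius d : ℚ) * 2 ^ (n / d)

/-- For even `n`, `∑_{k=1}^{n/2-1} r(k) r(n-k) + r(n/2) (r(n/2)+1) / 2`; for odd `n`,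
`∑_{k=1}^{⌊n/2⌋} r(k) r(n-k)`; here `r` is `selfReciprocalFormula`. -/
def wildFormula (n : ℕ) : ℚ :=
  if Even n then
    (∑ k ∈ Finset.Icc 1 (n / 2 - 1), selfReciprocalFormula k * selfReciprocalFormula (n - k))
      + selfReciprocalFormula (n / 2) * (selfReciprocalFormula (n / 2) + 1) / 2
  else
    ∑ k ∈ Finset.Icc 1 (n / 2), selfReciprocalFormula k * selfReciprocalFormula (n - k)

/-! The subring consists of the polynomials without linear term. The linear coefficient of `p * q`
is `p₀ q₁ + p₁ q₀`, so on polynomials with constant term `1` it is an additive class in `ZMod 2`,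
and membership means class `0`. An irreducible polynomial other than `X` is wild when its class is
`1`. A product with constant term `1` is therefore an atom of the subring exactly when it is a
single irreducible of class `0` or a product of two wild ones. If `X` divides a nonzero member `f`,
so does `X ^ 2`. Order at least `4` lets `X ^ 2` split off; for order `2` or `3` the cofactor may
have no nontrivial divisor of class `0`, so it is `1` or wild. This is `IsCuspIrred`.

For the count, sorting the elements of the field with `2 ^ n` elements by minimal polynomial and
inverting gives `a(n)`. Reversal turns the linear coefficient of a wild polynomial into its
next-to-leading one, which governs the trace. Half of the field has trace `1`, and such an element
has degree `d` with `n / d` odd, so inversion over odd divisors gives `r(n)`. Unique factorization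
in `(ZMod 2)[X]` keeps the families of atoms disjoint and counts the products of two wild
polynomials as unordered pairs. -/

namespace CuspRing

/-! ### Units and membership in the subring -/

/-- A unit polynomial over `F₂` is `1`. -/
lemma eq_one_of_isUnit {p : (ZMod 2)[X]} (h : IsUnit p) : p = 1 := by
  obtain ⟨c, hc, rfl⟩ := Polynomial.isUnit_iff.1 h
  have : c = 1 := by
    have h0 := hc.ne_zero
    clear h hc
    revert c; decide
  simp [this]

lemma eq_of_associated {p q : (ZMod 2)[X]} (h : Associated p q) : p = q := by
  obtain ⟨u, rfl⟩ := h
  simp [eq_one_of_isUnit u.isUnit]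

lemma zmod_two_cases (a : ZMod 2) : a = 0 ∨ a = 1 := by revert a; decide

lemma coeff_one_mul (p q : (ZMod 2)[X]) :
    (p * q).coeff 1 = p.coeff 0 * q.coeff 1 + p.coeff 1 * q.coeff 0 := by
  rw [coeff_mul, Finset.Nat.antidiagonal_succ]; simp

/-- Membership in the cusp ring is the vanishing of the linear coefficient. -/
lemma mem_cuspRing {f : (ZMod 2)[X]} : f ∈ cuspRing ↔ f.coeff 1 = 0 := by
  constructor
  · intro h
    refine Algebra.adjoin_induction (p := fun g _ => g.coeff 1 = 0) ?_ ?_ ?_ ?_ h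
    · rintro x (rfl | rfl) <;> simp [coeff_X_pow]
    · intro r
      rw [Polynomial.algebraMap_apply, coeff_C, if_neg one_ne_zero]
    · intro x y _ _ hx hy
      simp [hx, hy]
    · intro x y _ _ hx hy
      simp [coeff_one_mul, hx, hy]
  · intro h
    have hX : ∀ k : ℕ, k ≠ 1 → (X ^ k : (ZMod 2)[X]) ∈ cuspRing := by
      have h2 : (X ^ 2 : (ZMod 2)[X]) ∈ cuspRing := Algebra.subset_adjoin (by simp)
      have h3 : (X ^ 3 : (ZMod 2)[X]) ∈ cuspRing := Algebra.subset_adjoin (by simp)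
      intro k hk
      rcases Nat.even_or_odd' k with ⟨m, rfl | rfl⟩
      · rw [pow_mul]; exact pow_mem h2 m
      · obtain ⟨j, rfl⟩ : ∃ j, m = j + 1 := ⟨m - 1, by omega⟩
        have : (X ^ (2 * (j + 1) + 1) : (ZMod 2)[X]) = (X ^ 2) ^ j * X ^ 3 := by ring
        rw [this]
        exact mul_mem (pow_mem h2 j) h3
    rw [f.as_sum_support_C_mul_X_pow]
    refine sum_mem fun k hk => ?_
    have hk1 : k ≠ 1 := by rintro rfl; exact (mem_support_iff.1 hk) h
    rw [← smul_eq_C_mul]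
    exact Subalgebra.smul_mem _ (hX k hk1) _

/-! ### Classification of the irreducible elements -/

/-- Irreducible polynomials over `F₂` with constant and linear coefficient equal to `1`. -/
def IsWild (p : (ZMod 2)[X]) : Prop := Irreducible p ∧ p.coeff 0 = 1 ∧ p.coeff 1 = 1

lemma isUnit_cuspRing_iff {a : cuspRing} : IsUnit a ↔ (a : (ZMod 2)[X]) = 1 := by
  constructor
  · intro h
    exact eq_one_of_isUnit (h.map cuspRing.val)
  · intro h
    have : a = 1 := Subtype.ext h
    simp [this]

/-- Irreducibility in the cusp ring in terms of polynomials. -/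
lemma irreducible_cuspRing_iff {f : cuspRing} :
    Irreducible f ↔ (f : (ZMod 2)[X]) ≠ 1 ∧ ∀ a b : (ZMod 2)[X], a.coeff 1 = 0 → b.coeff 1 = 0 →
      (f : (ZMod 2)[X]) = a * b → a = 1 ∨ b = 1 := by
  rw [irreducible_iff, isUnit_cuspRing_iff]
  refine and_congr Iff.rfl ⟨fun h a b ha hb hab => ?_, fun h a b hab => ?_⟩
  · have := @h ⟨a, mem_cuspRing.2 ha⟩ ⟨b, mem_cuspRing.2 hb⟩ (Subtype.ext hab)
    simpa [isUnit_cuspRing_iff] using this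
  · rw [isUnit_cuspRing_iff, isUnit_cuspRing_iff]
    exact h _ _ (mem_cuspRing.1 a.2) (mem_cuspRing.1 b.2) (by rw [hab]; rfl)

lemma coeff_zero_eq_one_of_mul {p q : (ZMod 2)[X]} (h : (p * q).coeff 0 = 1) :
    p.coeff 0 = 1 ∧ q.coeff 0 = 1 := by
  rw [mul_coeff_zero] at h
  generalize p.coeff 0 = a at *
  generalize q.coeff 0 = b at *
  revert a b; decide

/-- A polynomial with constant coefficient `1` is `1`, is wild or has a nontrivial divisor in the
cusp ring. -/
lemma eq_one_or_isWild_or_exists_dvd {g : (ZMod 2)[X]} (hg : g.coeff 0 = 1) :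
    g = 1 ∨ IsWild g ∨ ∃ u v, g = u * v ∧ u ≠ 1 ∧ u.coeff 1 = 0 := by
  by_cases h1 : g = 1
  · exact Or.inl h1
  have hg0 : g ≠ 0 := by rintro rfl; simp at hg
  obtain ⟨p, hp, q, rfl⟩ := WfDvdMonoid.exists_irreducible_factor
    (fun h => h1 (eq_one_of_isUnit h)) hg0
  have ne1 : ∀ {p : (ZMod 2)[X]}, Irreducible p → p ≠ 1 := by
    rintro p hp rfl; exact hp.not_isUnit isUnit_one
  obtain ⟨hp0, hq0⟩ := coeff_zero_eq_one_of_mul hg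
  rcases zmod_two_cases (p.coeff 1) with hp1 | hp1
  · exact Or.inr (Or.inr ⟨p, q, rfl, ne1 hp, hp1⟩)
  by_cases hq : q = 1
  · subst hq
    exact Or.inr (Or.inl (by simpa using ⟨hp, hp0, hp1⟩))
  obtain ⟨q', hq', s, rfl⟩ := WfDvdMonoid.exists_irreducible_factor
    (fun h => hq (eq_one_of_isUnit h)) (right_ne_zero_of_mul hg0)
  obtain ⟨hq'0, -⟩ := coeff_zero_eq_one_of_mul hq0
  rcases zmod_two_cases (q'.coeff 1) with hq'1 | hq'1
  · exact Or.inr (Or.inr ⟨q', p * s, by ring, ne1 hq', hq'1⟩)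
  -- Two factors of class `1` multiply to class `1 + 1 = 0`.
  · refine Or.inr (Or.inr ⟨p * q', s, by ring, fun h => ?_, ?_⟩)
    · exact hp.not_isUnit (IsUnit.of_mul_eq_one _ h)
    · rw [coeff_one_mul, hp0, hp1, hq'0, hq'1]; decide

/-- Classification of the irreducible elements of the cusp ring. -/
def IsCuspIrred (f : (ZMod 2)[X]) : Prop :=
  (Irreducible f ∧ f.coeff 1 = 0) ∨ (∃ p q, IsWild p ∧ IsWild q ∧ f = p * q) ∨
    ∃ k, (k = 2 ∨ k = 3) ∧ (f = X ^ k ∨ ∃ p, IsWild p ∧ f = X ^ k * p)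

lemma isCuspIrred_of_irreducible {f : cuspRing} (hf : Irreducible f) :
    IsCuspIrred (f : (ZMod 2)[X]) := by
  have hf1 : (f : (ZMod 2)[X]).coeff 1 = 0 := mem_cuspRing.1 f.2
  have hf0 : (f : (ZMod 2)[X]) ≠ 0 := by
    intro h; exact hf.ne_zero (Subtype.ext h)
  obtain ⟨hne, hfac⟩ := irreducible_cuspRing_iff.1 hf
  generalize (f : (ZMod 2)[X]) = f at *
  rcases zmod_two_cases (f.coeff 0) with h0 | h0
  -- For `k ≥ 2` every multiple of `X ^ k` lies in the subring, so a divisor `u` of the cofactor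
  -- that lies there can always be split off.
  · have key : ∀ k h, 2 ≤ k → f = X ^ k * h → h.coeff 0 = 1 → h = 1 ∨ IsWild h := by
      intro k h hk hfh hh
      have hX : ∀ g : (ZMod 2)[X], (X ^ k * g).coeff 1 = 0 := fun g => by
        rw [coeff_X_pow_mul', if_neg (by omega)]
      rcases eq_one_or_isWild_or_exists_dvd hh with h | h | ⟨u, v, rfl, hu, hu1⟩
      · exact Or.inl h
      · exact Or.inr h
      · exfalso
        rcases hfac u (X ^ k * v) hu1 (hX v) (by rw [hfh]; ring) with h | h
        · exact hu h
        · have := congrArg (fun p => p.coeff 0) h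
          rw [coeff_X_pow_mul', if_neg (by omega)] at this
          simp at this
    obtain ⟨g, rfl⟩ := X_dvd_iff.2 h0
    have hg : g.coeff 0 = 0 := by simpa [coeff_X_mul] using hf1
    obtain ⟨g, rfl⟩ := X_dvd_iff.2 hg
    rcases zmod_two_cases (g.coeff 0) with hg | hg
    · obtain ⟨g, rfl⟩ := X_dvd_iff.2 hg
      rcases zmod_two_cases (g.coeff 0) with hg | hg
      · obtain ⟨g, rfl⟩ := X_dvd_iff.2 hg
        exfalso
        have hX : ∀ g : (ZMod 2)[X], (X ^ 2 * g).coeff 1 = 0 ∧ X ^ 2 * g ≠ 1 := fun g =>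
          ⟨by rw [coeff_X_pow_mul', if_neg (by omega)], fun h => by
            have := congrArg (fun p => p.coeff 0) h
            simp at this⟩
        -- Here `f = X ^ 4 * g`, which splits as `X ^ 2` times `X ^ 2 * g`.
        rcases hfac (X ^ 2 * 1) (X ^ 2 * g) (hX 1).1 (hX g).1 (by ring) with h | h
        · exact (hX _).2 h
        · exact (hX _).2 h
      · refine Or.inr (Or.inr ⟨3, Or.inr rfl, ?_⟩)
        rcases key 3 g (by omega) (by ring) hg with rfl | h
        · left; ring
        · right; exact ⟨g, h, by ring⟩
    · refine Or.inr (Or.inr ⟨2, Or.inl rfl, ?_⟩)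
      rcases key 2 g (by omega) (by ring) hg with rfl | h
      · left; ring
      · right; exact ⟨g, h, by ring⟩
  · obtain ⟨p, hp, q, rfl⟩ := WfDvdMonoid.exists_irreducible_factor
      (fun h => hne (eq_one_of_isUnit h)) hf0
    obtain ⟨hp0, hq0⟩ := coeff_zero_eq_one_of_mul h0
    have hpne : p ≠ 1 := by rintro rfl; exact hp.not_isUnit isUnit_one
    rw [coeff_one_mul, hp0, hq0] at hf1
    rcases zmod_two_cases (p.coeff 1) with hp1 | hp1
    · have hq1 : q.coeff 1 = 0 := by simpa [hp1] using hf1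
      rcases hfac p q hp1 hq1 rfl with h | rfl
      · exact absurd h hpne
      · left; simpa using ⟨hp, hp1⟩
    · have hq1 : q.coeff 1 = 1 := by
        rcases zmod_two_cases (q.coeff 1) with h | h
        · rw [hp1, h] at hf1; exact absurd hf1 (by decide)
        · exact h
      rcases eq_one_or_isWild_or_exists_dvd hq0 with rfl | h | ⟨u, v, rfl, hu, hu1⟩
      · simp [coeff_one] at hq1
      · exact Or.inr (Or.inl ⟨p, q, ⟨hp, hp0, hp1⟩, h, rfl⟩)
      · exfalso
        obtain ⟨hu0, hv0⟩ := coeff_zero_eq_one_of_mul hq0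
        rw [coeff_one_mul, hu0, hu1, hv0] at hq1
        -- Since `u` has class `0`, `v` inherits class `1` from `q`, and `p * v` has class `1 + 1 =
        -- 0`.
        have hpv : (p * v).coeff 1 = 0 := by
          rw [coeff_one_mul, hp0, hp1, hv0]
          simp at hq1; rw [hq1]; decide
        rcases hfac u (p * v) hu1 hpv (by ring) with h | h
        · exact hu h
        · exact hp.not_isUnit (IsUnit.of_mul_eq_one _ h)

lemma IsWild.ne_zero {p : (ZMod 2)[X]} (h : IsWild p) : p ≠ 0 := h.1.ne_zero

lemma IsWild.not_X_dvd {p : (ZMod 2)[X]} (h : IsWild p) : ¬ X ∣ p := by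
  rw [X_dvd_iff, h.2.1]; decide

/-- Factorizations of a power of `X` over `F₂`. -/
lemma eq_X_pow_of_mul {k : ℕ} {a b : (ZMod 2)[X]} (h : X ^ k = a * b) :
    ∃ i j, i + j = k ∧ a = X ^ i ∧ b = X ^ j := by
  obtain ⟨i, hi, ha⟩ := (dvd_prime_pow prime_X k).1 ⟨b, h⟩
  have ha := eq_of_associated ha
  subst ha
  refine ⟨i, k - i, by omega, rfl, ?_⟩
  have : (X : (ZMod 2)[X]) ^ k = X ^ i * X ^ (k - i) := by rw [← pow_add]; congr 1; omega
  rw [this] at h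
  exact (mul_left_cancel₀ (pow_ne_zero _ X_ne_zero) h).symm

lemma IsCuspIrred.coeff_one {f : (ZMod 2)[X]} (h : IsCuspIrred f) : f.coeff 1 = 0 := by
  rcases h with h | ⟨p, q, hp, hq, rfl⟩ | ⟨k, hk, rfl | ⟨p, -, rfl⟩⟩
  · exact h.2
  · rw [coeff_one_mul, hp.2.1, hp.2.2, hq.2.1, hq.2.2]; decide
  · rw [coeff_X_pow, if_neg (by omega)]
  · rw [coeff_X_pow_mul', if_neg (by omega)]

lemma irreducible_of_isCuspIrred {f : cuspRing} (hf : IsCuspIrred (f : (ZMod 2)[X])) :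
    Irreducible f := by
  rw [irreducible_cuspRing_iff]
  generalize (f : (ZMod 2)[X]) = f at *
  rcases hf with h | ⟨p, q, hp, hq, rfl⟩ | ⟨k, hk, rfl | ⟨p, hp, rfl⟩⟩
  · refine ⟨fun h1 => h.1.not_isUnit (h1 ▸ isUnit_one), fun a b _ _ hab => ?_⟩
    exact (h.1.isUnit_or_isUnit hab).imp eq_one_of_isUnit eq_one_of_isUnit
  · refine ⟨fun h => hp.1.not_isUnit (IsUnit.of_mul_eq_one _ h), ?_⟩
    -- The factor containing `p` cannot be `p` alone, which has class `1`, so it also absorbs the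
    -- irreducible `q`.
    have key : ∀ a b : (ZMod 2)[X], a.coeff 1 = 0 → p * q = a * b → p ∣ a → b = 1 := by
      rintro a b ha hab ⟨c, rfl⟩
      have hq' : q = c * b := mul_left_cancel₀ hp.ne_zero (by rw [hab]; ring)
      rcases hq.1.isUnit_or_isUnit hq' with h | h
      · have := eq_one_of_isUnit h
        subst this
        rw [mul_one, hp.2.2] at ha
        exact absurd ha (by decide)
      · exact eq_one_of_isUnit h
    intro a b ha hb hab
    rcases hp.1.prime.dvd_or_dvd ⟨q, hab.symm⟩ with h | h
    · exact Or.inr (key a b ha hab h)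
    · exact Or.inl (key b a hb (by rw [hab]; ring) h)
  · refine ⟨fun h => ?_, fun a b ha hb hab => ?_⟩
    · have := congrArg natDegree h
      simp at this; omega
    · obtain ⟨i, j, hij, rfl, rfl⟩ := eq_X_pow_of_mul hab
      have hi : i ≠ 1 := by rintro rfl; simp at ha
      have hj : j ≠ 1 := by rintro rfl; simp at hb
      have : i = 0 ∨ j = 0 := by omega
      rcases this with rfl | rfl <;> simp
  · refine ⟨fun h => hp.1.not_isUnit (IsUnit.of_mul_eq_one _ (mul_comm p _ ▸ h)), ?_⟩
    have key : ∀ a b : (ZMod 2)[X], a.coeff 1 = 0 → b.coeff 1 = 0 → X ^ k * p = a * b → p ∣ a →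
        b = 1 := by
      rintro a b ha hb hab ⟨c, rfl⟩
      have hX : X ^ k = c * b := mul_left_cancel₀ hp.ne_zero (by rw [mul_comm, hab]; ring)
      obtain ⟨i, j, hij, rfl, rfl⟩ := eq_X_pow_of_mul hX
      -- Neither `p` nor `p * X` lies in the subring, so `i ≥ 2`. As `k ≤ 3`, this leaves `j ≤ 1`,
      -- and `X` is not in the subring either.
      have hi : i ≠ 0 := by rintro rfl; simp [hp.2.2] at ha
      have hi' : i ≠ 1 := by
        rintro rfl
        rw [pow_one, coeff_mul_X, hp.2.1] at ha
        exact absurd ha (by decide)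
      have hj : j ≠ 1 := by rintro rfl; simp at hb
      have : j = 0 := by omega
      simp [this]
    intro a b ha hb hab
    rcases hp.1.prime.dvd_or_dvd (a := a) (b := b) ⟨X ^ k, by rw [← hab]; ring⟩ with h | h
    · exact Or.inr (key a b ha hb hab h)
    · exact Or.inl (key b a hb ha (by rw [hab]; ring) h)

/-- The irreducible elements of the cusp ring, counted as polynomials. -/
lemma cuspIrredCount_eq (n : ℕ) :
    cuspIrredCount n = Set.ncard {f : (ZMod 2)[X] | IsCuspIrred f ∧ f.natDegree = n} := by
  rw [cuspIrredCount, ← Set.ncard_image_of_injective _ Subtype.val_injective]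
  congr 1
  ext f
  constructor
  · rintro ⟨g, ⟨hg, hn⟩, rfl⟩
    exact ⟨isCuspIrred_of_irreducible hg, hn⟩
  · rintro ⟨hf, hn⟩
    exact ⟨⟨f, mem_cuspRing.2 hf.coeff_one⟩, ⟨irreducible_of_isCuspIrred hf, hn⟩, rfl⟩

/-! ### Irreducible polynomials and elements of finite fields -/

lemma monic_of_ne_zero {p : (ZMod 2)[X]} (h : p ≠ 0) : p.Monic :=
  (zmod_two_cases _).resolve_left (leadingCoeff_ne_zero.2 h)

lemma finite_natDegree_eq (n : ℕ) : {p : (ZMod 2)[X] | p.natDegree = n}.Finite := by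
  have : Finite (degreeLT (ZMod 2) (n + 1)) := (degreeLTEquiv (ZMod 2) (n + 1)).toEquiv.finite_iff.2
    inferInstance
  refine (Set.toFinite (degreeLT (ZMod 2) (n + 1) : Set (ZMod 2)[X])).subset fun p hp => ?_
  rw [SetLike.mem_coe, mem_degreeLT]
  refine degree_le_natDegree.trans_lt ?_
  rw [hp]
  exact_mod_cast Nat.lt_succ_self n

open Classical in
/-- The irreducible polynomials over `F₂` of degree `n` satisfying `Q`. -/
noncomputable def irredFinset (Q : (ZMod 2)[X] → Prop) (n : ℕ) : Finset (ZMod 2)[X] :=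
  (finite_natDegree_eq n).toFinset.filter fun p => Irreducible p ∧ Q p

@[simp]
lemma mem_irredFinset {Q : (ZMod 2)[X] → Prop} {n : ℕ} {p : (ZMod 2)[X]} :
    p ∈ irredFinset Q n ↔ p.natDegree = n ∧ Irreducible p ∧ Q p := by
  simp [irredFinset]

open Classical in
/-- An irreducible polynomial of degree dividing `n` is the minimal polynomial of as many elements
of the field with `2 ^ n` elements as its degree. -/
lemma card_minpoly_eq {n : ℕ} (hn : n ≠ 0) [Fintype (GaloisField 2 n)] {p : (ZMod 2)[X]}
    (hp : Irreducible p) (hd : p.natDegree ∣ n) :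
    (Finset.univ.filter fun x : GaloisField 2 n => minpoly (ZMod 2) x = p).card = p.natDegree := by
  have hmonic := monic_of_ne_zero hp.ne_zero
  -- As its degree divides `n`, `p` divides `X ^ 2 ^ n - X`, which splits in this field.
  have hsplit : Splits (p.map (algebraMap (ZMod 2) (GaloisField 2 n))) := by
    have hdvd := hp.natDegree_dvd_iff_dvd_X_pow_card_pow_sub_X.1 hd
    rw [Nat.card_zmod] at hdvd
    refine Splits.of_dvd ?_ ?_ (Polynomial.map_dvd _ hdvd)
    · exact SplittingField.splits (X ^ 2 ^ n - X : (ZMod 2)[X])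
    · exact (Polynomial.map_ne_zero_iff (algebraMap (ZMod 2) (GaloisField 2 n)).injective).2
        (FiniteField.X_pow_card_pow_sub_X_ne_zero _ hn (by norm_num))
  rw [← card_rootSet_eq_natDegree (PerfectField.separable_of_irreducible hp) hsplit,
    ← Set.toFinset_card]
  congr 1
  ext x
  simp only [Finset.mem_filter, Finset.mem_univ, true_and, Set.mem_toFinset]
  rw [mem_rootSet_of_ne hp.ne_zero]
  constructor
  · rintro rfl
    exact minpoly.aeval _ _
  · exact fun h => (minpoly.eq_of_irreducible_of_monic hp h hmonic).symm

open Classical in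
/-- Counting elements of the field with `2 ^ n` elements by their minimal polynomials. -/
lemma card_filter_minpoly {n : ℕ} (hn : n ≠ 0) [Fintype (GaloisField 2 n)]
    (Q : (ZMod 2)[X] → Prop) :
    (Finset.univ.filter fun x : GaloisField 2 n => Q (minpoly (ZMod 2) x)).card =
      ∑ d ∈ n.divisors, d * (irredFinset Q d).card := by
  have hirr : ∀ x : GaloisField 2 n, Irreducible (minpoly (ZMod 2) x) := fun x =>
    minpoly.irreducible (Algebra.IsIntegral.isIntegral x)
  have hdeg : ∀ x : GaloisField 2 n, (minpoly (ZMod 2) x).natDegree ∣ n := fun x => by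
    have := minpoly.degree_dvd (K := ZMod 2) (Algebra.IsIntegral.isIntegral x)
    rwa [GaloisField.finrank 2 hn] at this
  rw [Finset.card_eq_sum_card_fiberwise (f := fun x => minpoly (ZMod 2) x)
    (t := n.divisors.biUnion (irredFinset Q))]
  · rw [Finset.sum_biUnion]
    · refine Finset.sum_congr rfl fun d hd => ?_
      rw [mul_comm, ← smul_eq_mul, ← Finset.sum_const]
      refine Finset.sum_congr rfl fun p hp => ?_
      obtain ⟨rfl, hpi, hQ⟩ := mem_irredFinset.1 hp
      rw [← card_minpoly_eq hn hpi (Nat.dvd_of_mem_divisors hd), Finset.filter_filter]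
      congr 1
      ext x
      simp only [Finset.mem_filter, Finset.mem_univ, true_and]
      exact ⟨fun h => h.2, fun h => ⟨h ▸ hQ, h⟩⟩
    · intro d _ e _ hde
      refine Finset.disjoint_left.2 fun p hp hp' => hde ?_
      rw [← (mem_irredFinset.1 hp).1, (mem_irredFinset.1 hp').1]
  · intro x hx
    simp only [Finset.coe_biUnion, Set.mem_iUnion, Finset.mem_coe, mem_irredFinset]
    exact ⟨_, Nat.mem_divisors.2 ⟨hdeg x, hn⟩, rfl, hirr x, (Finset.mem_filter.1 hx).2⟩

lemma sum_card_irreducible {n : ℕ} (hn : n ≠ 0) :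
    ∑ d ∈ n.divisors, d * (irredFinset (fun _ => True) d).card = 2 ^ n := by
  classical
  have : Fintype (GaloisField 2 n) := Fintype.ofFinite _
  rw [← card_filter_minpoly hn]
  simp only [Finset.filter_true, Finset.card_univ]
  rw [← Nat.card_eq_fintype_card, GaloisField.card 2 n hn]

/-! ### Elements of trace one and reversal of coefficients -/

open Classical in
lemma card_trace_eq_one {n : ℕ} (hn : n ≠ 0) [Fintype (GaloisField 2 n)] :
    2 * (Finset.univ.filter fun x : GaloisField 2 n =>
      Algebra.trace (ZMod 2) (GaloisField 2 n) x = 1).card = 2 ^ n := by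
  obtain ⟨x₀, hx₀⟩ := Algebra.trace_surjective (ZMod 2) (GaloisField 2 n) 1
  have h : (Finset.univ.filter fun x : GaloisField 2 n =>
      Algebra.trace (ZMod 2) (GaloisField 2 n) x = 1).card =
      (Finset.univ.filter fun x : GaloisField 2 n =>
        ¬ Algebra.trace (ZMod 2) (GaloisField 2 n) x = 1).card := by
    -- Translation by an element of trace `1` exchanges the two trace classes.
    refine Finset.card_equiv (Equiv.addRight x₀) fun x => ?_
    simp only [Finset.mem_filter, Finset.mem_univ, true_and, Equiv.coe_addRight, map_add, hx₀]
    generalize (Algebra.trace (ZMod 2) (GaloisField 2 n)) x = a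
    revert a; decide
  have h2 := Finset.card_filter_add_card_filter_not (s := (Finset.univ : Finset (GaloisField 2 n)))
    (fun x => Algebra.trace (ZMod 2) (GaloisField 2 n) x = 1)
  rw [Finset.card_univ, ← Nat.card_eq_fintype_card, GaloisField.card 2 n hn] at h2
  omega

/-- The trace is, up to a sign invisible modulo `2`, the next-to-leading coefficient of the minimal
polynomial times the degree of the field over the subfield generated by `x`. That degree is `n`
divided by the degree of the minimal polynomial. -/
lemma trace_eq_one_iff {n : ℕ} (hn : n ≠ 0) (x : GaloisField 2 n) :
    Algebra.trace (ZMod 2) (GaloisField 2 n) x = 1 ↔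
      (Odd (n / (minpoly (ZMod 2) x).natDegree) ∧ (minpoly (ZMod 2) x).nextCoeff = 1) := by
  have hint : IsIntegral (ZMod 2) x := Algebra.IsIntegral.isIntegral x
  have h := Module.finrank_mul_finrank (ZMod 2) (IntermediateField.adjoin (ZMod 2) {x})
    (GaloisField 2 n)
  rw [IntermediateField.adjoin.finrank hint, GaloisField.finrank 2 hn] at h
  rw [trace_eq_finrank_mul_minpoly_nextCoeff, ← ZMod.natCast_eq_one_iff_odd,
    ← Nat.eq_div_of_mul_eq_right (minpoly.natDegree_pos hint).ne' h]
  generalize ((Module.finrank (IntermediateField.adjoin (ZMod 2) {x}) (GaloisField 2 n) : ℕ) :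
    ZMod 2) = a
  generalize (minpoly (ZMod 2) x).nextCoeff = b
  revert a b; decide

lemma sum_card_nextCoeff {n : ℕ} (hn : n ≠ 0) :
    ∑ d ∈ n.divisors with Odd (n / d),
      2 * (d * (irredFinset (fun p => p.nextCoeff = 1) d).card) = 2 ^ n := by
  classical
  have : Fintype (GaloisField 2 n) := Fintype.ofFinite _
  rw [← card_trace_eq_one hn, ← Finset.mul_sum]
  congr 1
  have hcard : (Finset.univ.filter fun x : GaloisField 2 n =>
      Algebra.trace (ZMod 2) (GaloisField 2 n) x = 1).card =
        ∑ d ∈ n.divisors, d * (irredFinset (fun p => Odd (n / p.natDegree) ∧ p.nextCoeff = 1) d).card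
      := by
    refine Eq.trans ?_
      (card_filter_minpoly hn (fun p => Odd (n / p.natDegree) ∧ p.nextCoeff = 1))
    congr 1
    ext x
    simp only [Finset.mem_filter, trace_eq_one_iff hn]
  rw [hcard, Finset.sum_filter]
  refine Finset.sum_congr rfl fun d _ => ?_
  split_ifs with h
  · congr 2
    ext p
    simp only [mem_irredFinset]
    constructor
    · rintro ⟨rfl, hp, h1⟩; exact ⟨rfl, hp, h, h1⟩
    · rintro ⟨rfl, hp, -, h1⟩; exact ⟨rfl, hp, h1⟩
  · symm
    rw [Nat.mul_eq_zero, Finset.card_eq_zero]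
    right
    ext p
    simp only [mem_irredFinset, Finset.notMem_empty, iff_false]
    rintro ⟨rfl, -, h1, -⟩
    exact h h1

/-- `mirror` is a multiplicative involution over a domain, so factorizations transfer in both
directions. -/
lemma irreducible_mirror {p : (ZMod 2)[X]} (hp : Irreducible p) : Irreducible p.mirror := by
  have hone : (1 : (ZMod 2)[X]).mirror = 1 := by rw [← C_1, mirror_C]
  have hunit : ∀ {a : (ZMod 2)[X]}, IsUnit a.mirror → IsUnit a := fun {a} h => by
    have := congrArg mirror (eq_one_of_isUnit h)
    rw [mirror_mirror, hone] at this
    exact this ▸ isUnit_one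
  refine ⟨fun h => hp.not_isUnit (hunit h), fun a b hab => ?_⟩
  have h : p = a.mirror * b.mirror := by
    rw [← mirror_mul_of_domain, ← hab, mirror_mirror]
  exact (hp.isUnit_or_isUnit h).imp hunit hunit

lemma mirror_eq_reverse {p : (ZMod 2)[X]} (h0 : p.coeff 0 ≠ 0) : p.mirror = p.reverse := by
  rw [mirror, natTrailingDegree_eq_zero.2 (Or.inr h0), pow_zero, mul_one]

lemma coeff_zero_mirror {p : (ZMod 2)[X]} (h0 : p.coeff 0 ≠ 0) : p.mirror.coeff 0 = 1 := by
  rw [mirror_eq_reverse h0, coeff_zero_reverse]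
  exact monic_of_ne_zero (by rintro rfl; simp at h0)

/-- Reversing coefficients exchanges the linear and the next-to-leading coefficient. -/
lemma card_nextCoeff_eq_card_wild (d : ℕ) :
    (irredFinset (fun p => p.nextCoeff = 1) d).card =
      (irredFinset (fun p => p.coeff 0 = 1 ∧ p.coeff 1 = 1) d).card := by
  refine Finset.card_nbij' mirror mirror ?_ ?_ (fun p _ => mirror_mirror p)
    (fun p _ => mirror_mirror p)
  · intro p hp
    obtain ⟨rfl, hirr, h1⟩ := mem_irredFinset.1 hp
    -- The only irreducible with zero constant term is `X`, whose `nextCoeff` is `0`.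
    have h0 : p.coeff 0 ≠ 0 := fun h => by
      have hX : (X : (ZMod 2)[X]) = p :=
        eq_of_associated (irreducible_X.associated_of_dvd hirr (X_dvd_iff.2 h))
      simp [← hX, nextCoeff] at h1
    refine mem_irredFinset.2 ⟨mirror_natDegree p, irreducible_mirror hirr, coeff_zero_mirror h0, ?_⟩
    rw [mirror_eq_reverse h0, coeff_one_reverse, h1]
  · intro p hp
    obtain ⟨rfl, hirr, h0, h1⟩ := mem_irredFinset.1 hp
    have h0' : p.coeff 0 ≠ 0 := by rw [h0]; decide
    refine mem_irredFinset.2 ⟨mirror_natDegree p, irreducible_mirror hirr, ?_⟩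
    have h0'' : p.mirror.coeff 0 ≠ 0 := by rw [coeff_zero_mirror h0']; decide
    rw [← coeff_one_reverse, ← mirror_eq_reverse h0'', mirror_mirror, h1]

/-! ### Möbius inversion -/

/-- The number of irreducible polynomials of degree `n`. -/
lemma necklaceFormula_eq {n : ℕ} (hn : 0 < n) :
    necklaceFormula n = (irredFinset (fun _ => True) n).card := by
  have h := (ArithmeticFunction.sum_eq_iff_sum_mul_moebius_eq (R := ℚ)
    (f := fun d => (d : ℚ) * (irredFinset (fun _ => True) d).card) (g := fun n => 2 ^ n)).1
    (fun n hn => by exact_mod_cast sum_card_irreducible hn.ne') n hn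
  rw [Nat.sum_divisorsAntidiagonal' (f := fun a b =>
    ((ArithmeticFunction.moebius a : ℤ) : ℚ) * 2 ^ b)] at h
  rw [necklaceFormula, h]
  field_simp

/-- The number of irreducible polynomials of degree `n` with constant and linear
coefficient `1`. -/
lemma selfReciprocalFormula_eq {n : ℕ} (hn : 0 < n) :
    selfReciprocalFormula n =
      (irredFinset (fun p => p.coeff 0 = 1 ∧ p.coeff 1 = 1) n).card := by
  -- The divisors of `2 ^ k * j`, `j` odd, with odd cofactor are `2 ^ k * i` for `i ∣ j`. With `k`
  -- fixed, the inversion thus runs over the odd numbers, a set closed under divisors.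
  obtain ⟨k, m, hm, rfl⟩ := Nat.exists_eq_two_pow_mul_odd hn.ne'
  have hdiv : ∀ j, Odd j → ∀ d, d ∣ j → Odd d := fun j hj d hd => hj.of_dvd_nat hd
  have hset : ∀ j, Odd j → ((2 ^ k * j).divisors.filter fun d => Odd (2 ^ k * j / d)) =
      j.divisors.image (2 ^ k * ·) := by
    intro j hj
    have hj0 : j ≠ 0 := by rintro rfl; exact absurd hj (by decide)
    ext d
    simp only [Finset.mem_filter, Nat.mem_divisors, Finset.mem_image]
    constructor
    · rintro ⟨⟨⟨e, he⟩, h0⟩, hodd⟩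
      have hd : 0 < d := Nat.pos_of_ne_zero (by rintro rfl; simp at he; omega)
      rw [he, Nat.mul_div_cancel_left _ hd] at hodd
      have hc : Nat.Coprime (2 ^ k) e := Nat.Coprime.pow_left _ (Nat.coprime_two_left.2 hodd)
      obtain ⟨i, rfl⟩ := hc.dvd_of_dvd_mul_right (he ▸ Dvd.intro j rfl : 2 ^ k ∣ d * e)
      refine ⟨i, ⟨⟨e, ?_⟩, hj0⟩, rfl⟩
      exact Nat.eq_of_mul_eq_mul_left (show 0 < 2 ^ k by positivity) (by rw [he]; ring)
    · rintro ⟨i, ⟨⟨e, rfl⟩, -⟩, rfl⟩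
      refine ⟨⟨⟨e, by ring⟩, by positivity⟩, ?_⟩
      have hi : 0 < i := Nat.pos_of_ne_zero (by rintro rfl; simp at hj0)
      rw [← mul_assoc, Nat.mul_div_cancel_left _ (by positivity)]
      exact hdiv _ hj _ (Dvd.intro_left i rfl)
  have h := (ArithmeticFunction.sum_eq_iff_sum_mul_moebius_eq_on (R := ℚ)
    (f := fun d => 2 * (((2 ^ k * d : ℕ) : ℚ) *
      (irredFinset (fun p => p.coeff 0 = 1 ∧ p.coeff 1 = 1) (2 ^ k * d)).card))
    (g := fun n => 2 ^ (2 ^ k * n)) {j | Odd j}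
    (fun a b hab hb => hdiv b hb a hab)).1
    (fun j hj hodd => by
      have h1 := sum_card_nextCoeff (n := 2 ^ k * j) (by positivity)
      rw [hset j hodd, Finset.sum_image fun a _ b _ hab =>
        Nat.eq_of_mul_eq_mul_left (by positivity) hab] at h1
      simp_rw [card_nextCoeff_eq_card_wild] at h1
      exact_mod_cast h1) m (Nat.pos_of_ne_zero (by rintro rfl; exact absurd hm (by decide))) hm
  rw [Nat.sum_divisorsAntidiagonal (f := fun a b =>
    ((ArithmeticFunction.moebius a : ℤ) : ℚ) * 2 ^ (2 ^ k * b))] at h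
  have hodd : ((2 ^ k * m).divisors.filter fun d => Odd d) = m.divisors := by
    ext d
    simp only [Finset.mem_filter, Nat.mem_divisors]
    constructor
    · rintro ⟨⟨hd, h0⟩, hodd⟩
      have hc : Nat.Coprime d (2 ^ k) := Nat.Coprime.pow_right _ (Nat.coprime_two_right.2 hodd)
      exact ⟨hc.dvd_of_dvd_mul_left hd, by rintro rfl; simp at h0⟩
    · rintro ⟨hd, h0⟩
      exact ⟨⟨hd.mul_left _, by positivity⟩, hdiv m hm d hd⟩
  have hsum : ∑ d ∈ m.divisors, (ArithmeticFunction.moebius d : ℚ) * 2 ^ (2 ^ k * m / d) =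
      ∑ d ∈ m.divisors, (ArithmeticFunction.moebius d : ℚ) * 2 ^ (2 ^ k * (m / d)) :=
    Finset.sum_congr rfl fun d hd => by rw [Nat.mul_div_assoc _ (Nat.dvd_of_mem_divisors hd)]
  rw [selfReciprocalFormula, hodd, hsum, h]
  have : ((2 ^ k * m : ℕ) : ℚ) ≠ 0 := by exact_mod_cast hn.ne'
  field_simp

/-! ### Counting products of two wild polynomials -/

/-- The wild polynomials of degree `n`. -/
noncomputable abbrev wildFinset (n : ℕ) : Finset (ZMod 2)[X] :=
  irredFinset (fun p => p.coeff 0 = 1 ∧ p.coeff 1 = 1) n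

lemma mem_wildFinset {n : ℕ} {p : (ZMod 2)[X]} :
    p ∈ wildFinset n ↔ p.natDegree = n ∧ IsWild p := mem_irredFinset

lemma card_irreducible_eq_add {n : ℕ} (hn : 2 ≤ n) :
    (irredFinset (fun _ => True) n).card =
      (irredFinset (fun p => p.coeff 1 = 0) n).card + (wildFinset n).card := by
  classical
  rw [← Finset.card_union_of_disjoint]
  · congr 1
    ext p
    simp only [Finset.mem_union, mem_irredFinset]
    constructor
    · rintro ⟨rfl, hp, -⟩
      rcases zmod_two_cases (p.coeff 1) with h1 | h1
      · exact Or.inl ⟨rfl, hp, h1⟩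
      -- A zero constant term would force `p = X`, of degree `1 < n`.
      · refine Or.inr ⟨rfl, hp, (zmod_two_cases _).resolve_left fun h => ?_, h1⟩
        have hX : (X : (ZMod 2)[X]) = p :=
          eq_of_associated (irreducible_X.associated_of_dvd hp (X_dvd_iff.2 h))
        rw [← hX, natDegree_X] at hn
        omega
    · rintro (⟨h, hp, -⟩ | ⟨h, hp, -⟩) <;> exact ⟨h, hp, trivial⟩
  · refine Finset.disjoint_left.2 fun p hp hp' => ?_
    have h := (mem_irredFinset.1 hp).2.2
    rw [(mem_irredFinset.1 hp').2.2.2] at h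
    exact absurd h (by decide)

lemma eq_or_eq_of_mul_eq_mul {p q p' q' : (ZMod 2)[X]} (hp : Irreducible p) (hp' : Irreducible p')
    (hq' : Irreducible q') (h : p * q = p' * q') : (p = p' ∧ q = q') ∨ (p = q' ∧ q = p') := by
  rcases hp.prime.dvd_or_dvd ⟨q, h.symm⟩ with hd | hd
  · obtain rfl := eq_of_associated (hp.associated_of_dvd hp' hd)
    exact Or.inl ⟨rfl, mul_left_cancel₀ hp.ne_zero h⟩
  · obtain rfl := eq_of_associated (hp.associated_of_dvd hq' hd)
    exact Or.inr ⟨rfl, mul_left_cancel₀ hp.ne_zero (by rw [h, mul_comm])⟩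

open Classical in
/-- Products of two wild polynomials of degrees `k` and `l`. -/
noncomputable def wildProducts (k l : ℕ) : Finset (ZMod 2)[X] :=
  (wildFinset k ×ˢ wildFinset l).image fun x => x.1 * x.2

lemma mem_wildProducts {k l : ℕ} {f : (ZMod 2)[X]} :
    f ∈ wildProducts k l ↔ ∃ p q, (p.natDegree = k ∧ IsWild p) ∧ (q.natDegree = l ∧ IsWild q) ∧
      p * q = f := by
  simp only [wildProducts, Finset.mem_image, Finset.mem_product, mem_wildFinset, Prod.exists,
    and_assoc]

lemma card_wildProducts_of_lt {k l : ℕ} (h : k < l) :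
    (wildProducts k l).card = (wildFinset k).card * (wildFinset l).card := by
  classical
  rw [wildProducts, Finset.card_image_of_injOn, Finset.card_product]
  rintro ⟨p, q⟩ hx ⟨p', q'⟩ hx' heq
  simp only [Finset.mem_coe, Finset.mem_product, mem_wildFinset] at hx hx'
  rcases eq_or_eq_of_mul_eq_mul hx.1.2.1 hx'.1.2.1 hx'.2.2.1 heq with ⟨rfl, rfl⟩ | ⟨rfl, rfl⟩
  · rfl
  · have := hx.1.1
    have := hx'.2.1
    omega

/-- In equal degrees the factors may be swapped or coincide; by unique factorization the product is
injective on unordered pairs. -/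
lemma card_wildProducts_self (k : ℕ) :
    (wildProducts k k).card = ((wildFinset k).card + 1).choose 2 := by
  classical
  rw [← Finset.card_sym2]
  have : wildProducts k k = (wildFinset k).sym2.image Sym2.mul := by
    ext f
    simp only [mem_wildProducts, Finset.mem_image, Sym2.exists, Finset.mk_mem_sym2_iff,
      mem_wildFinset, Sym2.mul_mk, and_assoc]
  rw [this, Finset.card_image_of_injOn]
  intro x hx y hy
  induction x using Sym2.ind with | _ p q => ?_
  induction y using Sym2.ind with | _ p' q' => ?_
  simp only [Finset.mem_coe, Finset.mk_mem_sym2_iff, mem_wildFinset] at hx hy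
  intro h
  exact Sym2.eq_iff.2 (eq_or_eq_of_mul_eq_mul hx.1.2.1 hy.1.2.1 hy.2.2.1 h)

lemma disjoint_wildProducts {k l k' l' : ℕ} (h : k + l = k' + l') (hk : k ≤ l) (hk' : k' ≤ l')
    (hne : k ≠ k') : Disjoint (wildProducts k l) (wildProducts k' l') := by
  refine Finset.disjoint_left.2 fun f hf hf' => hne ?_
  obtain ⟨p, q, ⟨rfl, hp⟩, ⟨rfl, hq⟩, rfl⟩ := mem_wildProducts.1 hf
  obtain ⟨p', q', ⟨rfl, hp'⟩, ⟨rfl, hq'⟩, he⟩ := mem_wildProducts.1 hf'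
  rcases eq_or_eq_of_mul_eq_mul hp.1 hp'.1 hq'.1 he.symm with ⟨rfl, rfl⟩ | ⟨rfl, rfl⟩
  · rfl
  · omega

open Classical in
/-- Products of two wild polynomials, of total degree `n`. -/
noncomputable def wildProductsOfDegree (n : ℕ) : Finset (ZMod 2)[X] :=
  (Finset.Icc 1 (n / 2)).biUnion fun k => wildProducts k (n - k)

lemma IsWild.natDegree_pos {p : (ZMod 2)[X]} (h : IsWild p) : 0 < p.natDegree :=
  h.1.natDegree_pos

lemma mem_wildProductsOfDegree {n : ℕ} {f : (ZMod 2)[X]} :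
    f ∈ wildProductsOfDegree n ↔ (∃ p q, IsWild p ∧ IsWild q ∧ f = p * q) ∧ f.natDegree = n := by
  simp only [wildProductsOfDegree, Finset.mem_biUnion, mem_wildProducts, Finset.mem_Icc]
  constructor
  · rintro ⟨k, hk, p, q, ⟨hpk, hp⟩, ⟨hqk, hq⟩, rfl⟩
    refine ⟨⟨p, q, hp, hq, rfl⟩, ?_⟩
    rw [natDegree_mul hp.ne_zero hq.ne_zero]
    omega
  · rintro ⟨⟨p, q, hp, hq, rfl⟩, hn⟩
    rw [natDegree_mul hp.ne_zero hq.ne_zero] at hn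
    have h1 := hp.natDegree_pos
    have h2 := hq.natDegree_pos
    rcases le_total p.natDegree q.natDegree with h | h
    · exact ⟨p.natDegree, by omega, p, q, ⟨rfl, hp⟩, ⟨by omega, hq⟩, rfl⟩
    · exact ⟨q.natDegree, by omega, q, p, ⟨rfl, hq⟩, ⟨by omega, hp⟩, mul_comm _ _⟩

lemma card_wildProductsOfDegree {n : ℕ} (hn : 2 ≤ n) :
    ((wildProductsOfDegree n).card : ℚ) = wildFormula n := by
  classical
  rw [wildProductsOfDegree, Finset.card_biUnion]
  · push_cast
    have hlt : ∀ k, 1 ≤ k → k < n - k → ((wildProducts k (n - k)).card : ℚ) =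
        selfReciprocalFormula k * selfReciprocalFormula (n - k) := fun k h1 h2 => by
      rw [card_wildProducts_of_lt h2, selfReciprocalFormula_eq h1,
        selfReciprocalFormula_eq (by omega)]
      push_cast; rfl
    rw [wildFormula]
    split_ifs with he
    · obtain ⟨m, rfl⟩ := he
      obtain ⟨j, rfl⟩ : ∃ j, m = j + 1 := ⟨m - 1, by omega⟩
      have h2 : (j + 1 + (j + 1)) / 2 = j + 1 := by omega
      -- The top index is the only one where both factors have the same degree.
      rw [h2, Finset.sum_Icc_succ_top (by omega), Nat.add_sub_cancel]
      congr 1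
      · refine Finset.sum_congr rfl fun k hk => hlt k ?_ ?_ <;>
          · have := Finset.mem_Icc.1 hk
            omega
      · rw [card_wildProducts_self, Nat.cast_choose_two,
          selfReciprocalFormula_eq (by omega)]
        push_cast; ring
    · refine Finset.sum_congr rfl fun k hk => ?_
      have := Finset.mem_Icc.1 hk
      have := Nat.not_even_iff.1 he
      exact hlt k (by omega) (by omega)
  · intro k hk k' hk' hne
    have := Finset.mem_Icc.1 (Finset.mem_coe.1 hk)
    have := Finset.mem_Icc.1 (Finset.mem_coe.1 hk')
    exact disjoint_wildProducts (by omega) (by omega) (by omega) hne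

open Classical in
-- Assembling the count in degree at least four
/-- Wild polynomials of degree `n - k` multiplied by `X ^ k`. -/
noncomputable def shiftedWild (k n : ℕ) : Finset (ZMod 2)[X] :=
  (wildFinset (n - k)).image (X ^ k * ·)

lemma card_shiftedWild (k n : ℕ) : (shiftedWild k n).card = (wildFinset (n - k)).card := by
  classical
  exact Finset.card_image_of_injective _ (mul_right_injective₀ (pow_ne_zero _ X_ne_zero))

lemma mem_shiftedWild {k n : ℕ} (hk : k < n) {f : (ZMod 2)[X]} :
    f ∈ shiftedWild k n ↔ (∃ p, IsWild p ∧ f = X ^ k * p) ∧ f.natDegree = n := by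
  have hdeg : ∀ p : (ZMod 2)[X], IsWild p → (X ^ k * p).natDegree = k + p.natDegree := fun p hp => by
    rw [natDegree_mul (pow_ne_zero _ X_ne_zero) hp.ne_zero, natDegree_X_pow]
  simp only [shiftedWild, Finset.mem_image, mem_wildFinset]
  constructor
  · rintro ⟨p, ⟨hn, hp⟩, rfl⟩
    exact ⟨⟨p, hp, rfl⟩, by rw [hdeg p hp]; omega⟩
  · rintro ⟨⟨p, hp, rfl⟩, hn⟩
    rw [hdeg p hp] at hn
    exact ⟨p, ⟨by omega, hp⟩, rfl⟩

lemma coeff_zero_of_mem_shiftedWild {k n : ℕ} (hk : 0 < k) {f : (ZMod 2)[X]}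
    (hf : f ∈ shiftedWild k n) : f.coeff 0 = 0 := by
  obtain ⟨p, -, rfl⟩ := Finset.mem_image.1 hf
  rw [coeff_X_pow_mul', if_neg (by omega)]

lemma setOf_isCuspIrred_eq {n : ℕ} (hn : 4 ≤ n) [DecidableEq (ZMod 2)[X]] :
    {f : (ZMod 2)[X] | IsCuspIrred f ∧ f.natDegree = n} =
      ↑(irredFinset (fun p => p.coeff 1 = 0) n ∪ (shiftedWild 2 n ∪ shiftedWild 3 n) ∪
        wildProductsOfDegree n) := by
  ext f
  simp only [Set.mem_ofPred_eq, Finset.mem_coe, Finset.mem_union, mem_irredFinset,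
    mem_shiftedWild (show 2 < n by omega), mem_shiftedWild (show 3 < n by omega),
    mem_wildProductsOfDegree]
  constructor
  · rintro ⟨h | h | ⟨k, hk, rfl | h⟩, hd⟩
    · exact Or.inl (Or.inl ⟨hd, h⟩)
    · exact Or.inr ⟨h, hd⟩
    -- The bare powers `X ^ 2` and `X ^ 3` have degree below `4`.
    · rw [natDegree_X_pow] at hd
      omega
    · rcases hk with rfl | rfl
      · exact Or.inl (Or.inr (Or.inl ⟨h, hd⟩))
      · exact Or.inl (Or.inr (Or.inr ⟨h, hd⟩))
  · rintro ((⟨hd, h⟩ | ⟨h, hd⟩ | ⟨h, hd⟩) | ⟨h, hd⟩)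
    · exact ⟨Or.inl h, hd⟩
    · exact ⟨Or.inr (Or.inr ⟨2, Or.inl rfl, Or.inr h⟩), hd⟩
    · exact ⟨Or.inr (Or.inr ⟨3, Or.inr rfl, Or.inr h⟩), hd⟩
    · exact ⟨Or.inr (Or.inl h), hd⟩

lemma cuspIrredCount_eq_of_four_le {n : ℕ} (hn : 4 ≤ n) :
    cuspIrredCount n = (irredFinset (fun p => p.coeff 1 = 0) n).card +
      ((wildFinset (n - 2)).card + (wildFinset (n - 3)).card) + (wildProductsOfDegree n).card := by
  classical
  have hX : ∀ k, 2 ≤ k → k < n →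
      Disjoint (irredFinset (fun p => p.coeff 1 = 0) n) (shiftedWild k n) := fun k hk hkn => by
    refine Finset.disjoint_left.2 fun f hf hf' => ?_
    obtain ⟨⟨p, hp, rfl⟩, -⟩ := (mem_shiftedWild hkn).1 hf'
    obtain ⟨-, hirr, -⟩ := mem_irredFinset.1 hf
    rcases hirr.isUnit_or_isUnit rfl with h | h
    · have := congrArg natDegree (eq_one_of_isUnit h)
      rw [natDegree_X_pow, natDegree_one] at this
      omega
    · exact hp.1.not_isUnit h
  rw [cuspIrredCount_eq, setOf_isCuspIrred_eq hn, Set.ncard_coe_finset,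
    Finset.card_union_of_disjoint, Finset.card_union_of_disjoint, Finset.card_union_of_disjoint,
    card_shiftedWild, card_shiftedWild]
  · refine Finset.disjoint_left.2 fun f hf hf' => ?_
    obtain ⟨⟨p, hp, rfl⟩, -⟩ := (mem_shiftedWild (by omega)).1 hf
    obtain ⟨⟨q, hq, h⟩, -⟩ := (mem_shiftedWild (by omega)).1 hf'
    -- From `X ^ 2 * p = X ^ 3 * q` it would follow that `X ∣ p`.
    refine hp.not_X_dvd ⟨q, mul_left_cancel₀ (pow_ne_zero 2 X_ne_zero) ?_⟩
    rw [h]; ring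
  · exact Finset.disjoint_union_right.2 ⟨hX 2 (by omega) (by omega), hX 3 (by omega) (by omega)⟩
  · refine Finset.disjoint_left.2 fun f hf hf' => ?_
    obtain ⟨⟨p, q, hp, hq, rfl⟩, -⟩ := mem_wildProductsOfDegree.1 hf'
    have h0 : (p * q).coeff 0 ≠ 0 := by
      rw [mul_coeff_zero, hp.2.1, hq.2.1]; decide
    rcases Finset.mem_union.1 hf with hf | hf
    · rcases (mem_irredFinset.1 hf).2.1.isUnit_or_isUnit rfl with h | h
      · exact hp.1.not_isUnit h
      · exact hq.1.not_isUnit h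
    · rcases Finset.mem_union.1 hf with hf | hf
      · exact h0 (coeff_zero_of_mem_shiftedWild (by omega) hf)
      · exact h0 (coeff_zero_of_mem_shiftedWild (by omega) hf)

/-! ### Degrees at most three -/

/-- In degrees `2` and `3` every element of the cusp ring is irreducible. -/
lemma cuspIrredCount_eq_ncard {n : ℕ} (hn : n = 2 ∨ n = 3) :
    cuspIrredCount n = Set.ncard {f : (ZMod 2)[X] | f.coeff 1 = 0 ∧ f.natDegree = n} := by
  rw [cuspIrredCount, ← Set.ncard_image_of_injective _ Subtype.val_injective]
  congr 1
  ext f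
  constructor
  · rintro ⟨g, ⟨-, hd⟩, rfl⟩
    exact ⟨mem_cuspRing.1 g.2, hd⟩
  · rintro ⟨hf, hd⟩
    refine ⟨⟨f, mem_cuspRing.2 hf⟩, ⟨irreducible_cuspRing_iff.2 ⟨?_, ?_⟩, hd⟩, rfl⟩
    · rintro rfl
      rw [natDegree_one] at hd
      omega
    · rintro a b ha hb (rfl : f = a * b)
      have h0 : a * b ≠ 0 := by
        intro h
        rw [h, natDegree_zero] at hd
        omega
      have ha0 := left_ne_zero_of_mul h0
      have hb0 := right_ne_zero_of_mul h0
      rw [natDegree_mul ha0 hb0] at hd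
      -- The subring has no element of degree `1`, so degrees adding up to at most `3` include a
      -- `0`.
      have key : ∀ c : (ZMod 2)[X], c ≠ 0 → c.coeff 1 = 0 → c.natDegree ≠ 1 := by
        intro c hc hc1 h
        have := monic_of_ne_zero hc
        rw [Monic, leadingCoeff, h, hc1] at this
        exact absurd this (by decide)
      have := key a ha0 ha
      have := key b hb0 hb
      have hcases : a.natDegree = 0 ∨ b.natDegree = 0 := by omega
      refine hcases.imp (fun h => ?_) (fun h => ?_)
      · exact (monic_of_ne_zero ha0).natDegree_eq_zero.1 h
      · exact (monic_of_ne_zero hb0).natDegree_eq_zero.1 h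

lemma cuspIrredCount_of_le_one {n : ℕ} (hn : n ≤ 1) : cuspIrredCount n = 0 := by
  rw [cuspIrredCount]
  refine (congrArg Set.ncard (Set.eq_empty_of_forall_notMem ?_)).trans (Set.ncard_empty _)
  rintro f ⟨hf, hd⟩
  -- Zero also has `natDegree` equal to `0` and must be excluded before concluding `f = 1`.
  have hne : (f : (ZMod 2)[X]) ≠ 0 := fun h => hf.ne_zero (Subtype.ext h)
  have hmonic := monic_of_ne_zero hne
  interval_cases n
  · exact (irreducible_cuspRing_iff.1 hf).1 (hmonic.natDegree_eq_zero.1 hd)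
  · rw [Monic, leadingCoeff, hd, mem_cuspRing.1 f.2] at hmonic
    exact absurd hmonic (by decide)

lemma cuspIrredCount_two : cuspIrredCount 2 = 2 := by
  classical
  rw [cuspIrredCount_eq_ncard (Or.inl rfl)]
  have : {f : (ZMod 2)[X] | f.coeff 1 = 0 ∧ f.natDegree = 2} =
      Set.range fun a : ZMod 2 => X ^ 2 + C a := by
    ext f
    constructor
    · rintro ⟨h1, hd⟩
      have hm : f.coeff 2 = 1 := by
        have hm : f.Monic := monic_of_ne_zero (by rintro rfl; simp at hd)
        rwa [Monic, leadingCoeff, hd] at hm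
      refine ⟨f.coeff 0, ?_⟩
      conv_rhs => rw [f.as_sum_range_C_mul_X_pow, hd]
      simp [Finset.sum_range_succ, h1, hm, add_comm]
    · rintro ⟨a, rfl⟩
      refine ⟨by simp [coeff_X_pow], by compute_degree!⟩
  rw [this, Set.ncard_range_of_injective, Nat.card_zmod]
  intro a b h
  simpa using h

lemma cuspIrredCount_three : cuspIrredCount 3 = 4 := by
  classical
  rw [cuspIrredCount_eq_ncard (Or.inr rfl)]
  have : {f : (ZMod 2)[X] | f.coeff 1 = 0 ∧ f.natDegree = 3} =
      Set.range fun a : ZMod 2 × ZMod 2 => X ^ 3 + C a.1 * X ^ 2 + C a.2 := by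
    ext f
    constructor
    · rintro ⟨h1, hd⟩
      have hm : f.coeff 3 = 1 := by
        have hm : f.Monic := monic_of_ne_zero (by rintro rfl; simp at hd)
        rwa [Monic, leadingCoeff, hd] at hm
      refine ⟨(f.coeff 2, f.coeff 0), ?_⟩
      conv_rhs => rw [f.as_sum_range_C_mul_X_pow, hd]
      simp [Finset.sum_range_succ, h1, hm]
      ring
    · rintro ⟨a, rfl⟩
      refine ⟨by simp [coeff_X_pow], ?_⟩
      rw [natDegree_add_C, natDegree_add_eq_left_of_natDegree_lt, natDegree_X_pow]
      rw [natDegree_X_pow]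
      exact (natDegree_C_mul_X_pow_le _ _).trans_lt (by norm_num)
  rw [this, Set.ncard_range_of_injective, Nat.card_prod, Nat.card_zmod]
  intro a b h
  have h2 := congrArg (fun p => p.coeff 2) h
  have h0 := congrArg (fun p => p.coeff 0) h
  simp [coeff_X_pow, coeff_C] at h2 h0
  exact Prod.ext h2 h0

end CuspRing

open CuspRing in
theorem theorem4p6 :
    (∀ n : ℕ, 4 ≤ n →
      (cuspIrredCount n : ℚ) =
        (necklaceFormula n - selfReciprocalFormula n)
          + (selfReciprocalFormula (n - 2) + selfReciprocalFormula (n - 3))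
          + wildFormula n) ∧
    cuspIrredCount 0 = 0 ∧ cuspIrredCount 1 = 0 ∧
    cuspIrredCount 2 = 2 ∧ cuspIrredCount 3 = 4 := by
  refine ⟨fun n hn => ?_, cuspIrredCount_of_le_one (by norm_num),
    cuspIrredCount_of_le_one le_rfl, cuspIrredCount_two, cuspIrredCount_three⟩
  rw [cuspIrredCount_eq_of_four_le hn, ← card_wildProductsOfDegree (by omega),
    necklaceFormula_eq (by omega), selfReciprocalFormula_eq (by omega),
    selfReciprocalFormula_eq (n := n - 2) (by omega),
    selfReciprocalFormula_eq (n := n - 3) (by omega), card_irreducible_eq_add (by omega)]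
  push_cast
  ring
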